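/- Let $(R,\mathfrak m)$ be a Cohen–Macaulay (Noetherian) local ring of dimension $d$ and let $I$ be an $\mathfrak m$-primary ideal of $R$ minimally generated by $x_1,\ldots,x_d,y$, where $J=(x_1,\ldots,x_d)$ is a reduction of $I$ with reduction number $r=\mathrm r_J(I)$, that is, $r$ is the least integer $n\ge 0$ with $I^{n+1}=JI^n$. Suppose that the initial forms $x_1^*,\ldots,x_{d-1}^*$ in the associated graded ring $G(I)=\bigoplus_{n\ge 0}I^n/I^{n+1}$ form a $G(I)$-regular sequence (the empty sequence if $d\le 1$). Let $V=R[X_1,\ldots,X_d,Y]$ be graded by total degree, with $V_n$ the forms of degree $n$, and let $Q=\bigoplus_{n\ge 1}Q_n$ be the kernel of the $R$-algebra map from $V$ onto the Rees algebra $R[It]=\bigoplus_{n\ge 0}I^nt^n$ sending $X_i\mapsto x_it$ and $Y\mapsto yt$. For $n\ge 1$ let $Q\langle n\rangle\subseteq Q$ be the ideal generated by the homogeneous elements of $Q$ of degree at most $n$, and let the relation type $\mathrm{rt}(I)$ be the least integer $N\ge 1$ with $Q=Q\langle N\rangle$. Then there are $F_1,\ldots,F_d\in V_r$ such that $Y^{r+1}-\sum_{i=1}^d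 X_iF_i\in Q_{r+1}$ and $$Q=\Bigl(Y^{r+1}-\sum_{i=1}^d X_iF_i\Bigr)+Q\langle r\rangle .$$ Moreover $\mathrm{rt}(I)=r+1$. -/

import Mathlib

namespace ReesEquations

open IsLocalRing RingTheory.Sequence

/-- The depth of a local ring: the supremum of the lengths of the regular sequences contained in
its maximal ideal. -/
noncomputable def depth (R : Type*) [CommRing R] [IsLocalRing R] : ℕ∞ :=
  ⨆ rs : {rs : List R // (∀ a ∈ rs, a ∈ maximalIdeal R) ∧ IsRegular R rs},
    (rs.1.length : ℕ∞)

/-- A local ring is Cohen-Macaulay if it is Noetherian and its depth equals its Krull dimension. -/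
structure IsCohenMacaulayLocal (R : Type*) [CommRing R] [IsLocalRing R] : Prop where
  isNoetherianRing : IsNoetherianRing R
  depth_eq_ringKrullDim : (depth R : WithBot ℕ∞) = ringKrullDim R

variable {R : Type*} [CommRing R]

/-- The family `z` of elements of `I` generates `I`, and no member of it can be omitted. -/
def IsMinimalGeneratingFamily {ι : Type*} {I : Ideal R} (z : ι → I) : Prop :=
  Ideal.span (Set.range fun i => (z i : R)) = I ∧
    ∀ i, Ideal.span ((fun j => (z j : R)) '' {j | j ≠ i}) ≠ I

/-- `J` is a reduction of `I`. -/
def IsReduction (J I : Ideal R) : Prop :=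
  J ≤ I ∧ ∃ n : ℕ, I ^ (n + 1) = J * I ^ n

/-- `r` is the reduction number of `I` with respect to `J`: the least `n ≥ 0` such that
`I ^ (n + 1) = J * I ^ n`. -/
def IsReductionNumber (J I : Ideal R) (r : ℕ) : Prop :=
  IsLeast {n : ℕ | I ^ (n + 1) = J * I ^ n} r

section AssociatedGraded

open Polynomial

/-- The ideal `⊕ I ^ (n + 1) t ^ n` of the Rees algebra `R[It] = ⊕ I ^ n t ^ n`. -/
def shiftIdeal (I : Ideal R) : Ideal (reesAlgebra I) where
  carrier := {f | ∀ n, (f : R[X]).coeff n ∈ I ^ (n + 1)}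
  add_mem' hf hg n := by
    simpa using Ideal.add_mem _ (hf n) (hg n)
  zero_mem' n := by simp
  smul_mem' g f hf n := by
    rw [smul_eq_mul, MulMemClass.coe_mul, coeff_mul]
    refine Ideal.sum_mem _ ?_
    rintro ⟨j, k⟩ e
    rw [← Finset.HasAntidiagonal.mem_antidiagonal.mp e, add_assoc, pow_add]
    exact Ideal.mul_mem_mul (g.2 j) (hf k)

/-- The associated graded ring `G(I) = ⊕ I ^ n / I ^ (n + 1)`, as the quotient of the Rees algebra
`⊕ I ^ n t ^ n` by `⊕ I ^ (n + 1) t ^ n`. -/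
abbrev AssociatedGraded (I : Ideal R) : Type _ :=
  reesAlgebra I ⧸ shiftIdeal I

/-- For `a ∈ I ^ n`, the class of `a` in the component `I ^ n / I ^ (n + 1)` of `G(I)`. -/
noncomputable def componentClass (I : Ideal R) (n : ℕ) (a : R) (ha : a ∈ I ^ n) :
    AssociatedGraded I :=
  Ideal.Quotient.mk (shiftIdeal I) ⟨monomial n a, reesAlgebra.monomial_mem.mpr ha⟩

open Classical in
/-- The initial form `a^*` in `G(I)`: the class of `a` in `I ^ n / I ^ (n + 1)`, where `n` is the
(unique) integer with `a ∈ I ^ n` and `a ∉ I ^ (n + 1)`; it is `0` if `a` lies in all `I ^ n`. -/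
noncomputable def initialForm (I : Ideal R) (a : R) : AssociatedGraded I :=
  if h : ∃ n : ℕ, a ∈ I ^ n ∧ a ∉ I ^ (n + 1) then
    componentClass I h.choose a h.choose_spec.1
  else 0

end AssociatedGraded

section Equations

variable {ι : Type*} {I : Ideal R}

/-- The presentation `R[T_i : i ∈ ι] → R[It]` sending `T_i` to `z_i t`. -/
noncomputable def presentation (z : ι → I) : MvPolynomial ι R →ₐ[R] reesAlgebra I :=
  MvPolynomial.aeval fun i =>
    (⟨Polynomial.monomial 1 (z i : R),
      reesAlgebra.monomial_mem.mpr ((pow_one I).symm ▸ (z i).2)⟩ : reesAlgebra I)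

/-- The ideal `Q` of equations of the Rees algebra: the kernel of the presentation. -/
noncomputable def equations (z : ι → I) : Ideal (MvPolynomial ι R) :=
  RingHom.ker (presentation z)

/-- The ideal `Q⟨n⟩` generated by the homogeneous equations of degree at most `n`. -/
noncomputable def equationsUpTo (z : ι → I) (n : ℕ) : Ideal (MvPolynomial ι R) :=
  Ideal.span {F | F ∈ equations z ∧ ∃ k ≤ n, F.IsHomogeneous k}

/-- `N` is the relation type: the least integer `N ≥ 1` such that `Q = Q⟨N⟩`. -/
def IsRelationType (z : ι → I) (N : ℕ) : Prop :=
  IsLeast {n : ℕ | 1 ≤ n ∧ equations z = equationsUpTo z n} N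

/-- The family `x_1, …, x_d, y`; the index `none` belongs to `y`. -/
def adjoinLast {d : ℕ} (x : Fin d → I) (y : I) : Option (Fin d) → I :=
  fun o => o.elim y x

end Equations

end ReesEquations

/-! A form of degree n + 1 is `C a * Y ^ (n + 1)` plus a combination of the X_i, so an equation of
degree above r can be reduced by the multiple of Y^(r+1) - ∑ X_i F_i that cancels its pure Y-power.
What remains is ∑ X_i G_i with ∑ x_i G_i(x, y) = 0, a syzygy of x with coefficients in a power of I.
`sum_X_mul_mem_span` writes it through equations of one degree less, and
`mem_span_sup_equationsUpTo` closes the induction on degree.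

The syzygy step eliminates the G_i from the last index down. It needs x_i to be regular modulo its
predecessors and K ∩ I^n = K I^(n-1), for n ≥ 1, where K is generated by those predecessors. The
second condition is the Valabrega–Valla criterion, deduced from the regularity of the first d - 1
initial forms (`IsInitiallyRegular.inf_pow_le`); the same hypothesis makes the first d - 1 of the
x_i regular. For x_d, the Cohen–Macaulay property gives a quotient of positive depth, and J contains
a power of the maximal ideal (`isRegularModulo_partialSpan`).

The bound r + 1 is sharp because an equation of degree at most r has a nonunit coefficient at its
pure Y-power, by minimality of r (`equationsUpTo_le_ker_specialization`). -/

namespace ReesEquations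

open IsLocalRing

/-! ### Depth through regular elements, socles and exchange. -/

section RegularModulo

variable {R : Type*} [CommRing R]

/-- `a` is a nonzerodivisor on `R ⧸ K`. -/
def IsRegularModulo (K : Ideal R) (a : R) : Prop :=
  ∀ u, a * u ∈ K → u ∈ K

/-- `R ⧸ K` has a weakly regular sequence of length `k` in the maximal ideal. -/
def HasRegularSequence [IsLocalRing R] : ℕ → Ideal R → Prop
  | 0, _ => True
  | k + 1, K => ∃ a ∈ maximalIdeal R, IsRegularModulo K a ∧ HasRegularSequence k (K ⊔ Ideal.span {a})

/-- The socle of `R ⧸ K` vanishes. -/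
def SocleVanishes [IsLocalRing R] (K : Ideal R) : Prop :=
  ∀ u, (∀ t ∈ maximalIdeal R, t * u ∈ K) → u ∈ K

theorem mem_sup_span_singleton_iff {K : Ideal R} {a u : R} :
    u ∈ K ⊔ Ideal.span {a} ↔ ∃ k ∈ K, ∃ v, u = k + a * v := by
  rw [sup_comm, Ideal.mem_span_singleton_sup]
  constructor
  · rintro ⟨v, k, hk, rfl⟩
    exact ⟨k, hk, v, by ring⟩
  · rintro ⟨k, hk, v, rfl⟩
    exact ⟨v, k, hk, by ring⟩

theorem IsRegularModulo.right_of_swap {K : Ideal R} {a z : R} (ha : IsRegularModulo K a)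
    (hz : IsRegularModulo (K ⊔ Ideal.span {a}) z) : IsRegularModulo (K ⊔ Ideal.span {z}) a := by
  intro u hu
  obtain ⟨k, hk, v, hv⟩ := mem_sup_span_singleton_iff.mp hu
  have : v ∈ K ⊔ Ideal.span {a} := hz v <| mem_sup_span_singleton_iff.mpr
    ⟨-k, K.neg_mem hk, u, by linear_combination -hv⟩
  obtain ⟨k', hk', w, rfl⟩ := mem_sup_span_singleton_iff.mp this
  have h : u - z * w ∈ K := ha _ <| by
    have : a * (u - z * w) = k + z * k' := by linear_combination hv
    rw [this]
    exact K.add_mem hk (K.mul_mem_left _ hk')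
  exact mem_sup_span_singleton_iff.mpr ⟨_, h, w, by ring⟩

variable [IsLocalRing R]

/-- Nakayama: regularity of z and then of a gives (K : z) ⊆ K + a (K : z). -/
theorem IsRegularModulo.left_of_swap [IsNoetherianRing R] {K : Ideal R} {a z : R}
    (ham : a ∈ maximalIdeal R) (ha : IsRegularModulo K a)
    (hz : IsRegularModulo (K ⊔ Ideal.span {a}) z) : IsRegularModulo K z := by
  let U : Ideal R := Submodule.comap (LinearMap.mulLeft R z) K
  have hU : U ≤ K ⊔ Ideal.span {a} • U := by
    intro u (hu : z * u ∈ K)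
    obtain ⟨k, hk, v, rfl⟩ := mem_sup_span_singleton_iff.mp
      (hz u (Ideal.mem_sup_left hu))
    refine Submodule.add_mem_sup hk (Submodule.smul_mem_smul (Ideal.mem_span_singleton_self a) ?_)
    refine ha _ ?_
    have h := K.sub_mem hu (K.mul_mem_left z hk)
    convert h using 1
    simp only [LinearMap.mulLeft_apply]
    ring
  have := Submodule.le_of_le_smul_of_le_jacobson_bot (IsNoetherian.noetherian U)
    (by
      rw [jacobson_eq_maximalIdeal ⊥ bot_ne_top, Ideal.span_singleton_le_iff_mem]
      exact ham) hU
  exact fun u hu => this hu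

theorem IsRegularModulo.socleVanishes {K : Ideal R} {a : R} (ham : a ∈ maximalIdeal R)
    (ha : IsRegularModulo K a) : SocleVanishes K :=
  fun u hu => ha u (hu a ham)

/-- An elementary form of the isomorphism of both socles with Ext¹(k, R/K), k the residue field: a
socle element u modulo K + (x) satisfies a u = x v modulo K, and v is a socle element modulo K +
(a). -/
theorem SocleVanishes.exchange {K : Ideal R} {a x : R} (ham : a ∈ maximalIdeal R)
    (hx : IsRegularModulo K x) (ha : IsRegularModulo K a)
    (hs : SocleVanishes (K ⊔ Ideal.span {a})) : SocleVanishes (K ⊔ Ideal.span {x}) := by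
  intro u hu
  obtain ⟨k, hk, v, hv⟩ := mem_sup_span_singleton_iff.mp (hu a ham)
  have : v ∈ K ⊔ Ideal.span {a} := hs v fun t ht => by
    obtain ⟨k', hk', w, hw⟩ := mem_sup_span_singleton_iff.mp (hu t ht)
    have h : t * v - a * w ∈ K := hx _ <| by
      have : x * (t * v - a * w) = a * k' - t * k := by linear_combination a * hw - t * hv
      rw [this]
      exact K.sub_mem (K.mul_mem_left _ hk') (K.mul_mem_left _ hk)
    exact mem_sup_span_singleton_iff.mpr ⟨_, h, w, by ring⟩
  obtain ⟨k', hk', w, rfl⟩ := mem_sup_span_singleton_iff.mp this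
  have h : u - x * w ∈ K := ha _ <| by
    have : a * (u - x * w) = k + x * k' := by linear_combination hv
    rw [this]
    exact K.add_mem hk (K.mul_mem_left _ hk')
  exact mem_sup_span_singleton_iff.mpr ⟨_, h, w, by ring⟩

/-- Prime avoidance on R/K × R/L: otherwise the maximal ideal lies in an associated prime, hence
kills a nonzero pair. -/
theorem SocleVanishes.exists_isRegularModulo [IsNoetherianRing R] {K L : Ideal R}
    (hK : SocleVanishes K) (hL : SocleVanishes L) :
    ∃ z ∈ maximalIdeal R, IsRegularModulo K z ∧ IsRegularModulo L z := by
  let M := (R ⧸ K) × (R ⧸ L)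
  by_cases h : ∃ z ∈ maximalIdeal R, z ∉ ⋃ p ∈ associatedPrimes R M, (p : Set R)
  · obtain ⟨z, hz, hzn⟩ := h
    rw [biUnion_associatedPrimes_eq_zero_divisors] at hzn
    have key : ∀ m : M, z • m = 0 → m = 0 := fun m hm => by
      by_contra hne
      exact hzn ⟨m, hne, hm⟩
    refine ⟨z, hz, fun u hu => ?_, fun u hu => ?_⟩
    · have := key (Ideal.Quotient.mk K u, 0) (Prod.ext (Ideal.Quotient.eq_zero_iff_mem.mpr hu)
        (smul_zero _))
      exact Ideal.Quotient.eq_zero_iff_mem.mp (congrArg Prod.fst this)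
    · have := key (0, Ideal.Quotient.mk L u) (Prod.ext (smul_zero _)
        (Ideal.Quotient.eq_zero_iff_mem.mpr hu))
      exact Ideal.Quotient.eq_zero_iff_mem.mp (congrArg Prod.snd this)
  · exfalso
    push Not at h
    obtain ⟨p, hp, hle⟩ := ((maximalIdeal R).subset_union_prime_finite
      (associatedPrimes.finite R M) (f := id) 0 0 fun _ h _ _ => h.isPrime).1 h
    have hp' : IsAssociatedPrime p M := hp
    obtain ⟨hprime, ⟨u, v⟩, huv⟩ := isAssociatedPrime_iff.mp hp'
    obtain ⟨u, rfl⟩ := Ideal.Quotient.mk_surjective u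
    obtain ⟨v, rfl⟩ := Ideal.Quotient.mk_surjective v
    have hmem : ∀ t ∈ maximalIdeal R,
        t • ((Ideal.Quotient.mk K u, Ideal.Quotient.mk L v) : M) = 0 := fun t ht => by
      have := hle ht
      simp only [id] at this
      rw [huv] at this
      exact Submodule.mem_colon_singleton.mp this
    have hu : u ∈ K := hK u fun t ht =>
      Ideal.Quotient.eq_zero_iff_mem.mp (congrArg Prod.fst (hmem t ht))
    have hv : v ∈ L := hL v fun t ht =>
      Ideal.Quotient.eq_zero_iff_mem.mp (congrArg Prod.snd (hmem t ht))
    apply hprime.ne_top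
    rw [huv, Ideal.Quotient.eq_zero_iff_mem.mpr hu, Ideal.Quotient.eq_zero_iff_mem.mpr hv]
    exact eq_top_iff.mpr fun t _ => Submodule.mem_colon_singleton.mpr (smul_zero (A := M) t)

/-- Every regular element of the maximal ideal starts a regular sequence of the given length. -/
theorem HasRegularSequence.sup_span_singleton [IsNoetherianRing R] {k : ℕ} :
    ∀ {K : Ideal R} {x : R}, HasRegularSequence (k + 1) K → x ∈ maximalIdeal R →
      IsRegularModulo K x → HasRegularSequence k (K ⊔ Ideal.span {x}) := by
  induction k with
  | zero => intros; trivial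
  | succ k ih =>
    rintro K x ⟨a, ham, ha, hK⟩ hxm hx
    have hsa : SocleVanishes (K ⊔ Ideal.span {a}) := by
      obtain ⟨b, hbm, hb, -⟩ := hK
      exact hb.socleVanishes hbm
    -- A common z links the two elements: the sequence a, z becomes z, a, then z, x by induction
    -- modulo z, and finally x, z.
    obtain ⟨z, hzm, hza, hzx⟩ := hsa.exists_isRegularModulo (hsa.exchange ham hx ha)
    have hz : IsRegularModulo K z := ha.left_of_swap ham hza
    have h1 := ih hK hzm hza
    rw [sup_right_comm] at h1
    have h2 : HasRegularSequence (k + 1) (K ⊔ Ideal.span {z}) :=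
      ⟨a, ham, ha.right_of_swap hza, h1⟩
    have h3 := ih h2 hxm (hx.right_of_swap hzx)
    rw [sup_right_comm] at h3
    exact ⟨z, hzm, hzx, h3⟩

theorem HasRegularSequence.of_succ {k : ℕ} :
    ∀ {K : Ideal R}, HasRegularSequence (k + 1) K → HasRegularSequence k K := by
  induction k with
  | zero => intros; trivial
  | succ k ih => exact fun ⟨a, ham, ha, h⟩ => ⟨a, ham, ha, ih h⟩

theorem HasRegularSequence.of_le {k l : ℕ} (hkl : k ≤ l) {K : Ideal R}
    (h : HasRegularSequence l K) : HasRegularSequence k K := by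
  induction hkl with
  | refl => exact h
  | step _ ih => exact ih h.of_succ

theorem isRegularModulo_of_isSMulRegular {A : Type*} [CommRing A] {K : Ideal A} {a : A}
    (h : IsSMulRegular (A ⧸ (K • ⊤ : Submodule A A)) a) : IsRegularModulo K a := by
  rw [show (K • ⊤ : Submodule A A) = K from by simp] at h
  intro u hu
  have : a • (Ideal.Quotient.mk K u) = a • 0 := by
    rw [smul_zero]
    exact Ideal.Quotient.eq_zero_iff_mem.mpr hu
  exact Ideal.Quotient.eq_zero_iff_mem.mp (h this)

theorem hasRegularSequence_of_isWeaklyRegular {rs : List R} (hm : ∀ a ∈ rs, a ∈ maximalIdeal R)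
    (h : RingTheory.Sequence.IsWeaklyRegular R rs) :
    HasRegularSequence rs.length (⊥ : Ideal R) := by
  -- Induction on the length k of the tail, taken modulo the entries that precede it.
  suffices H : ∀ k ≤ rs.length,
      HasRegularSequence k (Ideal.ofList (rs.take (rs.length - k))) by
    simpa using H rs.length le_rfl
  intro k
  induction k with
  | zero => intros; trivial
  | succ k ih =>
    intro hk
    have hlt : rs.length - (k + 1) < rs.length := by omega
    refine ⟨rs[rs.length - (k + 1)], hm _ (List.getElem_mem _),
      isRegularModulo_of_isSMulRegular (h.regular_mod_prev _ hlt), ?_⟩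
    have := ih (by omega)
    rw [show rs.length - k = rs.length - (k + 1) + 1 by omega, List.take_add_one,
      List.getElem?_eq_getElem hlt, Option.toList_some, Ideal.ofList_append,
      Ideal.ofList_singleton] at this
    exact this

theorem IsCohenMacaulayLocal.hasRegularSequence (hCM : IsCohenMacaulayLocal R) {d : ℕ}
    (hd : ringKrullDim R = d) : HasRegularSequence d (⊥ : Ideal R) := by
  have hdepth : depth R = d := by
    have := hCM.depth_eq_ringKrullDim.trans hd
    exact_mod_cast this
  rcases d with _ | d
  · trivial
  -- Depth is a supremum, so a strict inequality is what produces an actual sequence, here of length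
  -- at least d + 1.
  have hlt : (d : ℕ∞) < depth R := by
    rw [hdepth]
    exact_mod_cast d.lt_succ_self
  obtain ⟨⟨rs, hm, hreg⟩, h⟩ := lt_iSup_iff.mp hlt
  have h' : d < rs.length := by exact_mod_cast h
  exact (hasRegularSequence_of_isWeaklyRegular hm hreg.toIsWeaklyRegular).of_le h'

end RegularModulo

end ReesEquations

namespace ReesEquations

open IsLocalRing

/-! ### Homogeneous classes in the associated graded ring. -/

section InitialForms

variable {R : Type*} [CommRing R] {I : Ideal R}

theorem le_of_mem_pow_of_not_mem_pow {a : R} {m n : ℕ} (hm : a ∈ I ^ m) (hn : a ∉ I ^ (n + 1)) :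
    m ≤ n := by
  by_contra h
  exact hn (Ideal.pow_le_pow_right (by omega) hm)

theorem initialForm_eq_componentClass {n : ℕ} {a : R} (ha : a ∈ I ^ n) (ha' : a ∉ I ^ (n + 1)) :
    initialForm I a = componentClass I n a ha := by
  have h : ∃ n : ℕ, a ∈ I ^ n ∧ a ∉ I ^ (n + 1) := ⟨n, ha, ha'⟩
  have hn : h.choose = n := le_antisymm (le_of_mem_pow_of_not_mem_pow h.choose_spec.1 ha')
    (le_of_mem_pow_of_not_mem_pow ha h.choose_spec.2)
  rw [initialForm, dif_pos h]
  congr 1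

theorem componentClass_add {n : ℕ} {a b : R} (ha : a ∈ I ^ n) (hb : b ∈ I ^ n) :
    componentClass I n (a + b) (add_mem ha hb) =
      componentClass I n a ha + componentClass I n b hb := by
  rw [componentClass, componentClass, componentClass, ← map_add]
  congr 1
  ext1
  simp

theorem componentClass_mul {m n : ℕ} {a b : R} (ha : a ∈ I ^ m) (hb : b ∈ I ^ n)
    (hab : a * b ∈ I ^ (m + n)) :
    componentClass I (m + n) (a * b) hab = componentClass I m a ha * componentClass I n b hb := by
  rw [componentClass, componentClass, componentClass, ← map_mul]
  congr 1
  ext1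
  simp [Polynomial.monomial_mul_monomial]

theorem componentClass_eq_zero {n : ℕ} {a : R} (ha : a ∈ I ^ n) (ha' : a ∈ I ^ (n + 1)) :
    componentClass I n a ha = 0 := by
  refine Ideal.Quotient.eq_zero_iff_mem.mpr fun k => ?_
  simp only [Polynomial.coeff_monomial]
  split_ifs with h
  · exact h ▸ ha'
  · exact zero_mem _

/-- The elements of the Rees algebra whose component of degree `n` lies in
`K * I ^ (n - 1) + I ^ (n + 1)`. -/
def initialIdeal (I K : Ideal R) (hK : K ≤ I) : Ideal (reesAlgebra I) where
  carrier := {f | ∀ n, (f : Polynomial R).coeff n ∈ K * I ^ (n - 1) ⊔ I ^ (n + 1)}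
  add_mem' hf hg n := by
    simpa using Ideal.add_mem _ (hf n) (hg n)
  zero_mem' n := by simp
  smul_mem' g f hf n := by
    rw [smul_eq_mul, MulMemClass.coe_mul, Polynomial.coeff_mul]
    refine Ideal.sum_mem _ ?_
    rintro ⟨j, k⟩ e
    have e : j + k = n := Finset.HasAntidiagonal.mem_antidiagonal.mp e
    have h := Ideal.mul_mem_mul (g.2 j) (hf k)
    rw [Ideal.mul_sup, ← pow_add, ← add_assoc, e] at h
    suffices hle : I ^ j * (K * I ^ (k - 1)) ≤ K * I ^ (n - 1) ⊔ I ^ (n + 1) from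
      (sup_le hle le_sup_right : _ ≤ K * I ^ (n - 1) ⊔ I ^ (n + 1)) h
    rw [mul_left_comm, ← pow_add]
    rcases k with _ | k
    -- In degree 0 the truncated exponent makes the first summand K itself; as K ≤ I, its product
    -- with I^j falls into I^(n+1).
    · refine le_trans ?_ le_sup_right
      calc K * I ^ (j + (0 - 1)) ≤ I * I ^ j := Ideal.mul_mono hK (by simp)
        _ = I ^ (n + 1) := by rw [← pow_succ', ← e, add_zero]
    · refine le_trans ?_ le_sup_left
      rw [show n - 1 = j + (k + 1 - 1) by omega]

/-- Membership of a homogeneous class in the ideal generated by the classes in degree one of the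
elements of `S`, in terms of representatives. -/
theorem mem_of_componentClass_mem_span {S : Set R} (hS : S ⊆ I) {n : ℕ} {f : R} (hf : f ∈ I ^ n)
    (h : componentClass I n f hf ∈ Ideal.span {c | ∃ a, ∃ ha : a ∈ I ^ 1, a ∈ S ∧
      c = componentClass I 1 a ha}) :
    f ∈ Ideal.span S * I ^ (n - 1) ⊔ I ^ (n + 1) := by
  have hSI : Ideal.span S ≤ I := Ideal.span_le.mpr hS
  have hle : shiftIdeal I ≤ initialIdeal I (Ideal.span S) hSI :=
    fun g hg k => Ideal.mem_sup_right (hg k)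
  have hspan : Ideal.span {c | ∃ a, ∃ ha : a ∈ I ^ 1, a ∈ S ∧ c = componentClass I 1 a ha} ≤
      (initialIdeal I (Ideal.span S) hSI).map (Ideal.Quotient.mk (shiftIdeal I)) := by
    rw [Ideal.span_le]
    rintro _ ⟨a, ha, haS, rfl⟩
    refine Ideal.mem_map_of_mem _ fun k => ?_
    simp only [Polynomial.coeff_monomial]
    split_ifs with h
    · subst h
      refine Ideal.mem_sup_left ?_
      simpa using Ideal.subset_span haS
    · exact zero_mem _
  have := (Ideal.mem_quotient_iff_mem hle).mp (hspan h) n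
  simpa using this

theorem componentClass_mem_span {S : Set R} (hS : S ⊆ I) {n : ℕ} {f : R}
    (hf : f ∈ I ^ (n + 1)) (h : f ∈ Ideal.span S * I ^ n ⊔ I ^ (n + 2)) :
    componentClass I (n + 1) f hf ∈ Ideal.span {c | ∃ a, ∃ ha : a ∈ I ^ 1, a ∈ S ∧
      c = componentClass I 1 a ha} := by
  set T := Ideal.span {c | ∃ a, ∃ ha : a ∈ I ^ 1, a ∈ S ∧ c = componentClass I 1 a ha}
  have hle : Ideal.span S * I ^ n ≤ I ^ (n + 1) := by
    rw [pow_succ']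
    exact Ideal.mul_mono_left (Ideal.span_le.mpr hS)
  have key : ∀ g ∈ Ideal.span S * I ^ n, ∃ hg : g ∈ I ^ (n + 1),
      componentClass I (n + 1) g hg ∈ T := by
    intro g hg
    refine Submodule.smul_induction_on (p := fun g => ∃ hg : g ∈ I ^ (n + 1),
      componentClass I (n + 1) g hg ∈ T) hg ?_ ?_
    · intro a ha b hb
      refine Submodule.span_induction (p := fun a _ => ∀ c ∈ I ^ n, ∃ hg : a • c ∈ I ^ (n + 1),
        componentClass I (n + 1) (a • c) hg ∈ T) ?_ ?_ ?_ ?_ ha b hb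
      · intro a ha c hc
        have ha1 : a ∈ I ^ 1 := by simpa using hS ha
        have hca : c * a ∈ I ^ (n + 1) := by
          rw [pow_succ]
          exact Ideal.mul_mem_mul hc (hS ha)
        simp only [smul_eq_mul, mul_comm a c]
        refine ⟨hca, ?_⟩
        rw [componentClass_mul hc ha1]
        exact Ideal.mul_mem_left _ _ (Ideal.subset_span ⟨a, ha1, ha, rfl⟩)
      · intro c hc
        simp only [zero_smul]
        refine ⟨zero_mem _, ?_⟩
        rw [componentClass_eq_zero _ (zero_mem _)]
        exact zero_mem _
      · intro a b _ _ iha ihb c hc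
        obtain ⟨h1, h1'⟩ := iha c hc
        obtain ⟨h2, h2'⟩ := ihb c hc
        simp only [add_smul]
        refine ⟨add_mem h1 h2, ?_⟩
        rw [componentClass_add h1 h2]
        exact T.add_mem h1' h2'
      · intro t a _ iha c hc
        simp only [smul_assoc, smul_comm t a c]
        exact iha (t • c) (Ideal.mul_mem_left _ _ hc)
    · rintro a b ⟨h1, h1'⟩ ⟨h2, h2'⟩
      refine ⟨add_mem h1 h2, ?_⟩
      rw [componentClass_add h1 h2]
      exact T.add_mem h1' h2'
  obtain ⟨g, hg, w, hw, rfl⟩ := Submodule.mem_sup.mp h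
  rw [componentClass_add (hle hg) (Ideal.pow_le_pow_right (by omega) hw),
    componentClass_eq_zero _ hw, add_zero]
  exact (key g hg).2

end InitialForms

/-! ### The Valabrega–Valla criterion. -/

section ValabregaValla

variable {R : Type*} [CommRing R] {I K : Ideal R} {a : R}

/-- The class of `a` in degree one is a nonzerodivisor modulo the classes of `K` in degree one. -/
def IsInitiallyRegular (I K : Ideal R) (a : R) : Prop :=
  ∀ n, ∀ f ∈ I ^ n, a * f ∈ K * I ^ n ⊔ I ^ (n + 2) → f ∈ K * I ^ (n - 1) ⊔ I ^ (n + 1)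

/-- Krull's intersection theorem on R/K. -/
theorem mem_of_forall_mem_sup_pow [IsLocalRing R] [IsNoetherianRing R] (hI : I ≠ ⊤) {u : R}
    (h : ∀ n, u ∈ K ⊔ I ^ n) : u ∈ K := by
  have := Ideal.iInf_pow_smul_eq_bot_of_isLocalRing (M := R ⧸ K) I hI
  rw [← Ideal.Quotient.eq_zero_iff_mem, ← Submodule.mem_bot R, ← this, Submodule.mem_iInf]
  intro n
  obtain ⟨k, hk, f, hf, rfl⟩ := Submodule.mem_sup.mp (h n)
  rw [map_add, Ideal.Quotient.eq_zero_iff_mem.mpr hk, zero_add]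
  have := Submodule.smul_mem_smul hf (Submodule.mem_top (R := R) (x := (1 : R ⧸ K)))
  rwa [Algebra.smul_def, mul_one] at this

/-- If a u ∈ K, then modulo K the element u can be pushed into ever higher powers of I, hence
vanishes. -/
theorem IsInitiallyRegular.isRegularModulo [IsLocalRing R] [IsNoetherianRing R] (hI : I ≠ ⊤)
    (haI : a ∈ I) (hK : ∀ n, K ⊓ I ^ n ≤ K * I ^ (n - 1)) (ha : IsInitiallyRegular I K a) :
    IsRegularModulo K a := by
  intro u hu
  refine mem_of_forall_mem_sup_pow hI fun n => ?_
  induction n with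
  | zero => simp
  | succ n ih =>
    obtain ⟨c, hc, f, hf, rfl⟩ := Submodule.mem_sup.mp ih
    have h1 : a * f ∈ K := by
      have := K.sub_mem hu (K.mul_mem_left a hc)
      rwa [mul_add, add_sub_cancel_left] at this
    have h2 : a * f ∈ I ^ (n + 1) := by
      rw [pow_succ']
      exact Ideal.mul_mem_mul haI hf
    have h3 := ha n f hf (Ideal.mem_sup_left (hK (n + 1) ⟨h1, h2⟩))
    refine Ideal.add_mem _ (Ideal.mem_sup_left hc) ?_
    have hle : K * I ^ (n - 1) ⊔ I ^ (n + 1) ≤ K ⊔ I ^ (n + 1) :=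
      sup_le_sup_right Ideal.mul_le_left _
    exact hle h3

theorem IsInitiallyRegular.inf_pow_le (haI : a ∈ I)
    (hK : ∀ n, K ⊓ I ^ n ≤ K * I ^ (n - 1)) (ha : IsInitiallyRegular I K a) (n : ℕ) :
    (K ⊔ Ideal.span {a}) ⊓ I ^ n ≤ (K ⊔ Ideal.span {a}) * I ^ (n - 1) := by
  rintro z ⟨hz, hzn⟩
  rcases n with _ | n
  · simpa using hz
  -- While j < n, initial regularity applied to a u splits u as an element of K, absorbed into c,
  -- plus an element of I^(j+1).
  have key : ∀ j ≤ n, ∃ c ∈ K, ∃ u ∈ I ^ j, z = c + a * u := by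
    intro j
    induction j with
    | zero =>
      intro _
      obtain ⟨c, hc, u, rfl⟩ := mem_sup_span_singleton_iff.mp hz
      exact ⟨c, hc, u, by simp, rfl⟩
    | succ j ih =>
      intro hj
      obtain ⟨c, hc, u, hu, rfl⟩ := ih (by omega)
      have hau : a * u ∈ I ^ (j + 1) := by
        rw [pow_succ']
        exact Ideal.mul_mem_mul haI hu
      have hcj : c ∈ I ^ (j + 1) := by
        have := Ideal.sub_mem _ (Ideal.pow_le_pow_right (show j + 1 ≤ n + 1 by omega) hzn) hau
        rwa [add_sub_cancel_right] at this
      have h : a * u ∈ K * I ^ j ⊔ I ^ (j + 2) := by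
        have h1 : c ∈ K * I ^ j ⊔ I ^ (j + 2) := Ideal.mem_sup_left (hK (j + 1) ⟨hc, hcj⟩)
        have h2 : c + a * u ∈ K * I ^ j ⊔ I ^ (j + 2) :=
          Ideal.mem_sup_right (Ideal.pow_le_pow_right (by omega) hzn)
        simpa using Ideal.sub_mem _ h2 h1
      obtain ⟨c', hc', u', hu', rfl⟩ := Submodule.mem_sup.mp (ha j u hu h)
      exact ⟨c + a * c', K.add_mem hc (K.mul_mem_left _ (Ideal.mul_le_left (J := I ^ (j - 1)) hc')), u', hu',
        by ring⟩
  obtain ⟨c, hc, u, hu, rfl⟩ := key n le_rfl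
  have hau : a * u ∈ Ideal.span {a} * I ^ n :=
    Ideal.mul_mem_mul (Ideal.mem_span_singleton_self a) hu
  have hcn : c ∈ I ^ (n + 1) := by
    have : a * u ∈ I ^ (n + 1) := by
      rw [pow_succ']
      exact Ideal.mul_mem_mul haI hu
    simpa using Ideal.sub_mem _ hzn this
  rw [add_tsub_cancel_right, Ideal.sup_mul]
  exact Submodule.add_mem_sup (hK (n + 1) ⟨hc, hcn⟩) hau

end ValabregaValla

end ReesEquations

namespace ReesEquations

open IsLocalRing

/-! ### Initial segments of the sequence x and their regularity. -/

section PartialSpan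

variable {R : Type*} [CommRing R] {d : ℕ}

/-- The ideal generated by the first `k` members of a finite sequence. -/
def partialSpan (x : Fin d → R) (k : ℕ) : Ideal R :=
  Ideal.span (x '' {i | (i : ℕ) < k})

theorem partialSpan_zero (x : Fin d → R) : partialSpan x 0 = ⊥ := by
  simp [partialSpan]

theorem partialSpan_self (x : Fin d → R) : partialSpan x d = Ideal.span (Set.range x) := by
  simp [partialSpan]

theorem partialSpan_succ (x : Fin d → R) (i : Fin d) :
    partialSpan x (i + 1) = partialSpan x i ⊔ Ideal.span {x i} := by
  have : {j : Fin d | (j : ℕ) < i + 1} = {j : Fin d | (j : ℕ) < i} ∪ {i} := by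
    ext j
    simp only [Set.mem_ofPred_eq, Set.union_singleton, Set.mem_insert_iff, Fin.ext_iff]
    omega
  rw [partialSpan, partialSpan, this, Set.image_union, Set.image_singleton, Ideal.span_union]

theorem mem_partialSpan (x : Fin d → R) {i : Fin d} {k : ℕ} (h : (i : ℕ) < k) :
    x i ∈ partialSpan x k :=
  Ideal.subset_span ⟨i, h, rfl⟩

theorem exists_sum_of_mem_partialSpan_mul (x : Fin d → R) {k : ℕ} {L : Ideal R} {f : R}
    (hf : f ∈ partialSpan x k * L) :
    ∃ c : Fin d → R, (∀ i, c i ∈ L) ∧ (∀ i : Fin d, k ≤ i → c i = 0) ∧ f = ∑ i, x i * c i := by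
  have hadd : ∀ f g : R,
      (∃ c : Fin d → R, (∀ i, c i ∈ L) ∧ (∀ i : Fin d, k ≤ i → c i = 0) ∧ f = ∑ i, x i * c i) →
      (∃ c : Fin d → R, (∀ i, c i ∈ L) ∧ (∀ i : Fin d, k ≤ i → c i = 0) ∧ g = ∑ i, x i * c i) →
      ∃ c : Fin d → R, (∀ i, c i ∈ L) ∧ (∀ i : Fin d, k ≤ i → c i = 0) ∧
        f + g = ∑ i, x i * c i := by
    rintro f g ⟨c, hc, hc0, rfl⟩ ⟨e, he, he0, rfl⟩
    refine ⟨c + e, fun i => L.add_mem (hc i) (he i), fun i hi => ?_, ?_⟩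
    · simp [hc0 i hi, he0 i hi]
    · simp [mul_add, Finset.sum_add_distrib]
  refine Submodule.smul_induction_on hf ?_ hadd
  intro a ha b hb
  refine Submodule.span_induction (p := fun a _ => ∃ c : Fin d → R, (∀ i, c i ∈ L) ∧
    (∀ i : Fin d, k ≤ i → c i = 0) ∧ a • b = ∑ i, x i * c i) ?_ ?_ ?_ ?_ ha
  · rintro _ ⟨j, hj, rfl⟩
    refine ⟨Pi.single j b, fun i => ?_, fun i hi => ?_, ?_⟩
    · rcases eq_or_ne i j with rfl | h
      · simpa using hb
      · simp [h]
    · have hj : (j : ℕ) < k := hj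
      have : i ≠ j := fun h => by subst h; omega
      simp [this]
    · simp [Pi.single_apply]
  · exact ⟨0, by simp, by simp, by simp⟩
  · intro a a' _ _ h h'
    rw [add_smul]
    exact hadd _ _ h h'
  · rintro t a _ ⟨c, hc, hc0, h⟩
    refine ⟨fun i => t * c i, fun i => L.mul_mem_left _ (hc i), fun i hi => ?_, ?_⟩
    · simp [hc0 i hi]
    · rw [smul_assoc, h, smul_eq_mul, Finset.mul_sum]
      exact Finset.sum_congr rfl fun i _ => by ring

end PartialSpan

section Regularity

variable {R : Type*} [CommRing R] {d : ℕ} {I : Ideal R}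

/-- By Nakayama a generator in I² would be redundant. Hence each initial form of x_i sits in degree
one. -/
theorem IsMinimalGeneratingFamily.not_mem_sq [IsLocalRing R] [IsNoetherianRing R] {ι : Type*}
    {z : ι → I} (hz : IsMinimalGeneratingFamily z) (hI : I ≠ ⊤) (i : ι) : (z i : R) ∉ I ^ 2 := by
  intro h
  apply hz.2 i
  set N := Ideal.span ((fun j => (z j : R)) '' {j | j ≠ i})
  refine le_antisymm (Ideal.span_le.mpr ?_) ?_
  · rintro _ ⟨j, -, rfl⟩
    exact (z j).2
  refine Submodule.le_of_le_smul_of_le_jacobson_bot (I := maximalIdeal R)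
    (IsNoetherian.noetherian I) (jacobson_eq_maximalIdeal ⊥ bot_ne_top).ge ?_
  conv_lhs => rw [← hz.1]
  refine Ideal.span_le.mpr ?_
  rintro _ ⟨j, rfl⟩
  by_cases hj : j = i
  · subst hj
    refine Ideal.mem_sup_right ?_
    rw [sq] at h
    exact Ideal.mul_mono_left (le_maximalIdeal hI) h
  · exact Ideal.mem_sup_left (Ideal.subset_span ⟨j, hj, rfl⟩)

theorem isInitiallyRegular_of_isWeaklyRegular {x : Fin d → R} (hx : ∀ i, x i ∈ I)
    (hx2 : ∀ i, x i ∉ I ^ 2) {m : ℕ}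
    (h : RingTheory.Sequence.IsWeaklyRegular (AssociatedGraded I)
      ((List.ofFn fun i => initialForm I (x i)).take m)) (i : Fin d) (hi : (i : ℕ) < m) :
    IsInitiallyRegular I (partialSpan x i) (x i) := by
  have hx1 : ∀ i, x i ∈ I ^ 1 := fun i => by simpa using hx i
  have hform : ∀ i, initialForm I (x i) = componentClass I 1 (x i) (hx1 i) :=
    fun i => initialForm_eq_componentClass (hx1 i) (hx2 i)
  set S : Set R := x '' {j | (j : ℕ) < i} with hS
  have hSI : S ⊆ I := by
    rintro _ ⟨j, -, rfl⟩
    exact hx j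
  have hlist : Ideal.ofList (((List.ofFn fun i => initialForm I (x i)).take m).take i) =
      Ideal.span {c | ∃ a, ∃ ha : a ∈ I ^ 1, a ∈ S ∧ c = componentClass I 1 a ha} := by
    rw [Ideal.ofList]
    congr 1
    ext c
    rw [List.take_take, min_eq_left hi.le]
    simp only [Set.mem_ofPred_eq, List.mem_take_iff_getElem, List.length_ofFn, List.getElem_ofFn]
    constructor
    · rintro ⟨j, hj, rfl⟩
      exact ⟨x ⟨j, by omega⟩, hx1 _, ⟨⟨j, by omega⟩, show j < (i : ℕ) by omega, rfl⟩, hform _⟩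
    · rintro ⟨_, _, ⟨j, hj, rfl⟩, rfl⟩
      have hj : (j : ℕ) < i := hj
      exact ⟨j, by omega, hform j⟩
  have hlen : (i : ℕ) < ((List.ofFn fun i => initialForm I (x i)).take m).length := by
    simp [hi]
  have hreg := isRegularModulo_of_isSMulRegular (h.regular_mod_prev i hlen)
  rw [hlist] at hreg
  simp only [List.getElem_take, List.getElem_ofFn, hform] at hreg
  intro n f hf hxf
  refine mem_of_componentClass_mem_span hSI hf (hreg _ ?_)
  have hmem : f * x i ∈ I ^ (n + 1) := by
    rw [pow_succ]
    exact Ideal.mul_mem_mul hf (hx i)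
  have hmul := componentClass_mul hf (hx1 i) hmem
  rw [mul_comm (componentClass I n f hf)] at hmul
  have hspan := componentClass_mem_span hSI hmem (by rwa [mul_comm f])
  rw [hmul] at hspan
  exact hspan

theorem partialSpan_inf_pow_le {x : Fin d → R} (hx : ∀ i, x i ∈ I) {k : ℕ} (hk : k ≤ d)
    (h : ∀ i : Fin d, (i : ℕ) < k → IsInitiallyRegular I (partialSpan x i) (x i)) (n : ℕ) :
    partialSpan x k ⊓ I ^ n ≤ partialSpan x k * I ^ (n - 1) := by
  induction k generalizing n with
  | zero => simp [partialSpan_zero]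
  | succ k ih =>
    have hi := partialSpan_succ x ⟨k, hk⟩
    simp only at hi
    rw [hi]
    exact (h ⟨k, hk⟩ k.lt_succ_self).inf_pow_le (hx _)
      (ih (by omega) fun i hi => h i (by omega)) n

variable [IsLocalRing R]

theorem hasRegularSequence_partialSpan [IsNoetherianRing R] {x : Fin d → R}
    (hx : ∀ i, x i ∈ maximalIdeal R) (hR : HasRegularSequence d (⊥ : Ideal R)) {k : ℕ}
    (hk : k ≤ d) (h : ∀ i : Fin d, (i : ℕ) < k → IsRegularModulo (partialSpan x i) (x i)) :
    HasRegularSequence (d - k) (partialSpan x k) := by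
  induction k with
  | zero => simpa [partialSpan_zero] using hR
  | succ k ih =>
    have := ih (by omega) fun i hi => h i (by omega)
    rw [show d - k = d - (k + 1) + 1 by omega] at this
    have h' := this.sup_span_singleton (hx ⟨k, hk⟩) (h ⟨k, hk⟩ k.lt_succ_self)
    rwa [← partialSpan_succ x ⟨k, hk⟩] at h'

theorem SocleVanishes.mem_of_pow {K : Ideal R} (hK : SocleVanishes K) (N : ℕ) :
    ∀ {u : R}, (∀ t ∈ maximalIdeal R ^ N, t * u ∈ K) → u ∈ K := by
  induction N with
  | zero =>
    intro u h
    simpa using h 1 (by simp)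
  | succ N ih =>
    intro u h
    refine ih fun t ht => hK _ fun s hs => ?_
    rw [← mul_assoc]
    exact h _ (by rw [pow_succ']; exact Ideal.mul_mem_mul hs ht)

/-- If a u ∈ K, then K + (a), and so a power of the maximal ideal, multiplies u into K. -/
theorem SocleVanishes.isRegularModulo {K : Ideal R} (hK : SocleVanishes K) {a : R} {N : ℕ}
    (hN : maximalIdeal R ^ N ≤ K ⊔ Ideal.span {a}) : IsRegularModulo K a := by
  intro u hu
  refine hK.mem_of_pow N fun t ht => ?_
  obtain ⟨k, hk, v, rfl⟩ := mem_sup_span_singleton_iff.mp (hN ht)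
  have : (k + a * v) * u = u * k + v * (a * u) := by ring
  rw [this]
  exact K.add_mem (K.mul_mem_left _ hk) (K.mul_mem_left _ hu)

/-- In a Cohen-Macaulay local ring, a system of parameters all of whose members but the last have
initial forms that are a regular sequence is a regular sequence. -/
theorem isRegularModulo_partialSpan [IsNoetherianRing R] (hI : I ≠ ⊤)
    {x : Fin d → R} (hx : ∀ i, x i ∈ I)
    (hR : HasRegularSequence d (⊥ : Ideal R))
    (h : ∀ i : Fin d, (i : ℕ) < d - 1 → IsInitiallyRegular I (partialSpan x i) (x i))
    {N : ℕ} (hN : maximalIdeal R ^ N ≤ Ideal.span (Set.range x)) (i : Fin d) :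
    IsRegularModulo (partialSpan x i) (x i) := by
  have hlt : ∀ i : Fin d, (i : ℕ) < d - 1 → IsRegularModulo (partialSpan x i) (x i) :=
    fun i hi => (h i hi).isRegularModulo hI (hx i)
      (partialSpan_inf_pow_le hx i.2.le fun j hj => h j (by omega))
  by_cases hi : (i : ℕ) < d - 1
  · exact hlt i hi
  have hseq := hasRegularSequence_partialSpan (fun i => le_maximalIdeal hI (hx i)) hR i.2.le
    fun j hj => hlt j (by omega)
  -- Only the last index remains: the quotient by the earlier elements has a regular element, so its
  -- socle vanishes.
  rw [show d - (i : ℕ) = 0 + 1 by omega] at hseq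
  obtain ⟨a, ham, ha, -⟩ := hseq
  refine (ha.socleVanishes ham).isRegularModulo (N := N) (hN.trans_eq ?_)
  rw [← partialSpan_succ, show (i : ℕ) + 1 = d by omega, partialSpan_self]

end Regularity

end ReesEquations

namespace ReesEquations

open IsLocalRing MvPolynomial

/-! ### Homogeneous equations and their values at the generators. -/

section Equations

variable {R : Type*} [CommRing R] {I : Ideal R} {ι : Type*}

theorem coeff_presentation (z : ι → I) (F : MvPolynomial ι R) (n : ℕ) :
    (presentation z F : Polynomial R).coeff n =
      aeval (fun i => (z i : R)) (homogeneousComponent n F) := by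
  induction F using MvPolynomial.induction_on' with
  | monomial s a =>
    rw [homogeneousComponent_of_mem (isHomogeneous_monomial a (rfl : s.degree = s.degree))]
    have h : (presentation z (monomial s a) : Polynomial R) =
        Polynomial.monomial s.degree (aeval (fun i => (z i : R)) (monomial s a)) := by
      rw [presentation, aeval_monomial, aeval_monomial]
      simp only [Finsupp.prod, MulMemClass.coe_mul, SubmonoidClass.coe_finsetProd,
        SubmonoidClass.coe_pow, Polynomial.monomial_pow, one_mul, Subalgebra.coe_algebraMap]
      rw [Finset.prod_congr rfl fun i _ =>
        (Polynomial.C_mul_X_pow_eq_monomial (a := (z i : R) ^ s i) (n := s i)).symm,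
        Finset.prod_mul_distrib, Finset.prod_pow_eq_pow_sum, ← Polynomial.C_mul_X_pow_eq_monomial]
      simp [Finsupp.degree_apply, map_prod, mul_assoc]
    rw [h, Polynomial.coeff_monomial]
    by_cases hn : s.degree = n
    · rw [if_pos hn, if_pos hn.symm]
    · rw [if_neg hn, if_neg (Ne.symm hn), map_zero]
  | add p q hp hq => simp [hp, hq]

theorem mem_equations_iff_of_isHomogeneous {z : ι → I} {F : MvPolynomial ι R} {n : ℕ}
    (hF : F.IsHomogeneous n) :
    F ∈ equations z ↔ aeval (fun i => (z i : R)) F = 0 := by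
  rw [equations, RingHom.mem_ker]
  have hc := fun m => coeff_presentation z F m
  simp only [homogeneousComponent_of_mem hF] at hc
  constructor
  · intro h
    have := hc n
    rw [h] at this
    simpa using this.symm
  · intro h
    ext m
    rw [hc m]
    split_ifs <;> simp [h]

theorem homogeneousComponent_mem_equations {z : ι → I} {F : MvPolynomial ι R}
    (hF : F ∈ equations z) (n : ℕ) : homogeneousComponent n F ∈ equations z := by
  rw [mem_equations_iff_of_isHomogeneous (homogeneousComponent_isHomogeneous n F),
    ← coeff_presentation]
  rw [equations, RingHom.mem_ker] at hF
  simp [hF]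

theorem exists_isHomogeneous_aeval_eq {z : ι → I}
    (hz : Ideal.span (Set.range fun i => (z i : R)) = I) {n : ℕ} {f : R} (hf : f ∈ I ^ n) :
    ∃ G : MvPolynomial ι R, G.IsHomogeneous n ∧ aeval (fun i => (z i : R)) G = f := by
  rw [← hz, Ideal.mem_span_pow_iff_exists_isHomogeneous] at hf
  simpa [aeval_eq_eval] using hf

theorem aeval_mem_pow {z : ι → I} (hz : Ideal.span (Set.range fun i => (z i : R)) = I) {n : ℕ}
    {G : MvPolynomial ι R} (hG : G.IsHomogeneous n) : aeval (fun i => (z i : R)) G ∈ I ^ n := by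
  have := (Ideal.mem_span_pow_iff_exists_isHomogeneous (n := n) (fun i => (z i : R))
    (aeval (fun i => (z i : R)) G)).mpr ⟨G, hG, by simp [aeval_eq_eval]⟩
  rwa [hz] at this

theorem equationsUpTo_le_equations (z : ι → I) (n : ℕ) : equationsUpTo z n ≤ equations z :=
  Ideal.span_le.mpr fun _ h => h.1

theorem equationsUpTo_mono (z : ι → I) {m n : ℕ} (h : m ≤ n) :
    equationsUpTo z m ≤ equationsUpTo z n :=
  Ideal.span_mono fun _ ⟨hF, k, hk, hFk⟩ => ⟨hF, k, hk.trans h, hFk⟩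

end Equations

section Adjoin

variable {R : Type*} [CommRing R] {I : Ideal R} {d : ℕ} {x : Fin d → I} {y : I}

/-- Every monomial other than the pure power of Y is divisible by some X_i. -/
theorem exists_decomposition_of_isHomogeneous_succ {F : MvPolynomial (Option (Fin d)) R} {n : ℕ}
    (hF : F.IsHomogeneous (n + 1)) :
    ∃ (a : R) (G : Fin d → MvPolynomial (Option (Fin d)) R), (∀ i, (G i).IsHomogeneous n) ∧
      F = C a * X none ^ (n + 1) + ∑ i, X (some i) * G i := by
  rw [F.as_sum]
  refine Finset.sum_induction _ (fun F => ∃ (a : R) (G : Fin d → MvPolynomial (Option (Fin d)) R),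
    (∀ i, (G i).IsHomogeneous n) ∧ F = C a * X none ^ (n + 1) + ∑ i, X (some i) * G i) ?_ ?_ ?_
  · rintro _ _ ⟨a, G, hG, rfl⟩ ⟨b, H, hH, rfl⟩
    refine ⟨a + b, G + H, fun i => (hG i).add (hH i), ?_⟩
    simp only [C_add, Pi.add_apply, mul_add, Finset.sum_add_distrib]
    ring
  · exact ⟨0, 0, fun _ => isHomogeneous_zero _ _ _, by simp⟩
  · intro s hs
    have hdeg : s.degree = n + 1 := (hF.degree_eq_sum_deg_support hs).symm
    by_cases h : ∃ i, s (some i) ≠ 0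
    · obtain ⟨i, hi⟩ := h
      have hle : Finsupp.single (some i) 1 ≤ s := by
        rw [Finsupp.single_le_iff]
        omega
      obtain ⟨t, rfl⟩ := exists_add_of_le hle
      have ht : t.degree = n := by
        rw [map_add, Finsupp.degree_single] at hdeg
        omega
      refine ⟨0, Pi.single i (monomial t (coeff (Finsupp.single (some i) 1 + t) F)), fun j => ?_, ?_⟩
      · rcases eq_or_ne j i with rfl | hj
        · simpa using isHomogeneous_monomial _ ht
        · simpa [hj] using isHomogeneous_zero _ _ _
      · simp [Pi.single_apply, X, monomial_mul]
    · push Not at h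
      have hs' : s = Finsupp.single none (n + 1) := by
        have hs'' : s = Finsupp.single none (s none) := by
          ext o
          cases o <;> simp [h]
        rw [hs'', Finsupp.degree_single] at hdeg
        rw [hs'', hdeg]
      refine ⟨coeff s F, 0, fun _ => isHomogeneous_zero _ _ _, ?_⟩
      simp [hs', C_mul_X_pow_eq_monomial]

/-- A linear syzygy of `x` with coefficients in the Rees algebra, of positive degree, is
generated by equations of smaller degree. -/
theorem sum_X_mul_mem_span
    (hz : Ideal.span (Set.range fun o => (adjoinLast x y o : R)) = I)
    (hreg : ∀ i : Fin d, IsRegularModulo (partialSpan (fun i => (x i : R)) i) (x i : R))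
    (hinf : ∀ (i : Fin d) (n : ℕ), partialSpan (fun i => (x i : R)) i ⊓ I ^ n ≤
      partialSpan (fun i => (x i : R)) i * I ^ (n - 1)) {n : ℕ} (k : ℕ) :
    ∀ G : Fin d → MvPolynomial (Option (Fin d)) R, (∀ i, (G i).IsHomogeneous (n + 1)) →
      (∀ i : Fin d, k ≤ i → G i = 0) →
      ∑ i, (x i : R) * aeval (fun o => (adjoinLast x y o : R)) (G i) = 0 →
      ∑ i, X (some i) * G i ∈
        Ideal.span {F | F ∈ equations (adjoinLast x y) ∧ F.IsHomogeneous (n + 1)} := by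
  induction k with
  | zero =>
    intro G _ hG _
    simp [hG]
  | succ k ih =>
    intro G hG hG0 hsum
    by_cases hk : d ≤ k
    · exact ih G hG (fun i hi => absurd i.2 (by omega)) hsum
    let i : Fin d := ⟨k, by omega⟩
    let ev := aeval (R := R) (fun o => (adjoinLast x y o : R))
    have hxg : (x i : R) * ev (G i) ∈ partialSpan (fun i => (x i : R)) i := by
      rw [← Finset.add_sum_erase _ _ (Finset.mem_univ i)] at hsum
      rw [eq_neg_of_add_eq_zero_left hsum]
      refine Ideal.neg_mem_iff _ |>.mpr (Ideal.sum_mem _ fun j hj => ?_)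
      have hji : j ≠ i := Finset.ne_of_mem_erase hj
      have hji' : (j : ℕ) ≠ k := fun h => hji (Fin.ext h)
      by_cases hjk : (j : ℕ) < k
      · exact Ideal.mul_mem_right _ _ (mem_partialSpan (fun i => (x i : R)) hjk)
      · rw [hG0 j (by omega)]
        simp
    -- Regularity puts the last coefficient in the ideal of the earlier x_j; the intersection
    -- condition lets its coefficients be taken in I^n, so they lift to forms of degree n.
    obtain ⟨c, hc, hc0, hgc⟩ := exists_sum_of_mem_partialSpan_mul _
      (hinf i (n + 1) ⟨hreg i _ hxg, aeval_mem_pow hz (hG i)⟩)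
    rw [Nat.add_sub_cancel] at hc
    have hlift : ∀ j : Fin d, ∃ C : MvPolynomial (Option (Fin d)) R, C.IsHomogeneous n ∧
        ev C = c j ∧ (k ≤ j → C = 0) := by
      intro j
      by_cases hj : k ≤ j
      · exact ⟨0, isHomogeneous_zero _ _ _, by rw [map_zero, hc0 j hj], fun _ => rfl⟩
      · obtain ⟨C, hC, hCc⟩ := exists_isHomogeneous_aeval_eq hz (hc j)
        exact ⟨C, hC, hCc, fun h => absurd h hj⟩
    choose C hC hCc hC0 using hlift
    have hXC : ∀ j k : Fin d, (X (some j) * C k).IsHomogeneous (n + 1) := fun j k => by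
      rw [add_comm]
      exact (isHomogeneous_X R _).mul (hC k)
    have hevX : ∀ j : Fin d, ev (X (some j)) = x j := fun j => by
      simp [ev, adjoinLast]
    -- A Koszul move: X_i ∑ X_j C_j is redistributed over the j < i, and the i-th entry is deleted.
    -- The difference G_i - ∑ X_j C_j is itself an equation.
    let G' : Fin d → MvPolynomial (Option (Fin d)) R :=
      fun j => G j + X (some i) * C j - if j = i then G i else 0
    have hG' : ∀ j, (G' j).IsHomogeneous (n + 1) := fun j => by
      refine ((hG j).add (hXC i j)).sub ?_
      split_ifs
      · exact hG i
      · exact isHomogeneous_zero _ _ _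
    have hG'0 : ∀ j : Fin d, k ≤ j → G' j = 0 := fun j hj => by
      simp only [G', hC0 j hj]
      split_ifs with h
      · simp [h]
      · have : (j : ℕ) ≠ k := fun h' => h (Fin.ext h')
        simp [hG0 j (by omega)]
    have hdecomp : ∑ j, X (some j) * G j =
        X (some i) * (G i - ∑ j, X (some j) * C j) + ∑ j, X (some j) * G' j := by
      have h1 : ∑ j, X (some j) * (X (some i) * C j) = X (some i) * ∑ j, X (some j) * C j := by
        rw [Finset.mul_sum]
        exact Finset.sum_congr rfl fun j _ => by ring
      simp only [G', mul_sub, mul_add, Finset.sum_sub_distrib, Finset.sum_add_distrib, h1,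
        mul_ite, mul_zero, Finset.sum_ite_eq', Finset.mem_univ, if_true]
      ring
    have hD : ev (G i - ∑ j, X (some j) * C j) = 0 := by
      rw [map_sub, map_sum, sub_eq_zero]
      simp only [map_mul, hevX, hCc]
      exact hgc
    rw [hdecomp]
    refine Ideal.add_mem _ (Ideal.mul_mem_left _ _ (Ideal.subset_span ?_)) (ih G' hG' hG'0 ?_)
    · have hhom := (hG i).sub (IsHomogeneous.sum Finset.univ _ _ fun j _ => hXC j j)
      exact ⟨(mem_equations_iff_of_isHomogeneous hhom).mpr hD, hhom⟩
    · have h := congrArg ev hdecomp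
      simp only [map_add, map_mul, map_sum, hevX, hD, mul_zero, zero_add] at h
      rw [← h]
      exact hsum

end Adjoin

end ReesEquations

namespace ReesEquations

open IsLocalRing MvPolynomial

/-! ### The top-degree equation and the relation type. -/

section Top

variable {R : Type*} [CommRing R] {I : Ideal R} {d : ℕ} {x : Fin d → I} {y : I}

theorem aeval_adjoinLast_decomposition (a : R) (G : Fin d → MvPolynomial (Option (Fin d)) R)
    (n : ℕ) :
    aeval (fun o => (adjoinLast x y o : R)) (C a * X none ^ n + ∑ i, X (some i) * G i) =
      a * (y : R) ^ n + ∑ i, (x i : R) * aeval (fun o => (adjoinLast x y o : R)) (G i) := by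
  simp [adjoinLast]

theorem exists_equation_of_pow_eq
    (hz : Ideal.span (Set.range fun o => (adjoinLast x y o : R)) = I) {r : ℕ}
    (hr : I ^ (r + 1) = Ideal.span (Set.range fun i => (x i : R)) * I ^ r) :
    ∃ F : Fin d → MvPolynomial (Option (Fin d)) R, (∀ i, (F i).IsHomogeneous r) ∧
      (y : R) ^ (r + 1) =
        ∑ i, (x i : R) * aeval (fun o => (adjoinLast x y o : R)) (F i) := by
  have hy : (y : R) ^ (r + 1) ∈ partialSpan (fun i => (x i : R)) d * I ^ r := by
    rw [partialSpan_self, ← hr]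
    exact Ideal.pow_mem_pow y.2 _
  obtain ⟨c, hc, -, hyc⟩ := exists_sum_of_mem_partialSpan_mul _ hy
  choose F hF hFc using fun i => exists_isHomogeneous_aeval_eq hz (hc i)
  exact ⟨F, hF, by simp only [hFc, hyc]⟩

theorem isHomogeneous_X_pow_sub_sum {F : Fin d → MvPolynomial (Option (Fin d)) R} {r : ℕ}
    (hF : ∀ i, (F i).IsHomogeneous r) :
    (X none ^ (r + 1) - ∑ i, X (some i) * F i :
      MvPolynomial (Option (Fin d)) R).IsHomogeneous (r + 1) := by
  refine (isHomogeneous_X_pow _ _).sub (IsHomogeneous.sum _ _ _ fun i _ => ?_)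
  rw [add_comm]
  exact (isHomogeneous_X R _).mul (hF i)

theorem mem_span_sup_equationsUpTo
    (hz : Ideal.span (Set.range fun o => (adjoinLast x y o : R)) = I)
    (hreg : ∀ i : Fin d, IsRegularModulo (partialSpan (fun i => (x i : R)) i) (x i : R))
    (hinf : ∀ (i : Fin d) (n : ℕ), partialSpan (fun i => (x i : R)) i ⊓ I ^ n ≤
      partialSpan (fun i => (x i : R)) i * I ^ (n - 1))
    {r : ℕ} (hr : 1 ≤ r) {F : Fin d → MvPolynomial (Option (Fin d)) R}
    (hF : ∀ i, (F i).IsHomogeneous r)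
    (hyF : (y : R) ^ (r + 1) =
      ∑ i, (x i : R) * aeval (fun o => (adjoinLast x y o : R)) (F i)) (n : ℕ) :
    ∀ E ∈ equations (adjoinLast x y), E.IsHomogeneous n →
      E ∈ Ideal.span {X none ^ (r + 1) - ∑ i, X (some i) * F i} ⊔
        equationsUpTo (adjoinLast x y) r := by
  induction n with
  | zero => exact fun E hE hE0 => Ideal.mem_sup_right (Ideal.subset_span ⟨hE, 0, zero_le, hE0⟩)
  | succ n ih =>
    intro E hE hEn
    by_cases hnr : n + 1 ≤ r
    · exact Ideal.mem_sup_right (Ideal.subset_span ⟨hE, n + 1, hnr, hEn⟩)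
    obtain ⟨m, rfl⟩ : ∃ m, n = m + r := ⟨n - r, by omega⟩
    obtain ⟨a, G, hG, rfl⟩ := exists_decomposition_of_isHomogeneous_succ hEn
    have hdecomp : C a * X none ^ (m + r + 1) + ∑ i, X (some i) * G i =
        C a * X none ^ m * (X none ^ (r + 1) - ∑ i, X (some i) * F i) +
          ∑ i, X (some i) * (G i + C a * X none ^ m * F i) := by
      have h1 : ∑ i, X (some i) * (C a * X none ^ m * F i) =
          C a * X none ^ m * ∑ i, X (some i) * F i := by
        rw [Finset.mul_sum]
        exact Finset.sum_congr rfl fun i _ => by ring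
      simp only [mul_add, Finset.sum_add_distrib, h1]
      ring
    have hH : ∀ i, (G i + C a * X none ^ m * F i).IsHomogeneous (m + r) := fun i =>
      (hG i).add ((isHomogeneous_C_mul_X_pow a none m).mul (hF i))
    have hsum : ∑ i, (x i : R) * aeval (fun o => (adjoinLast x y o : R))
        (G i + C a * X none ^ m * F i) = 0 := by
      rw [mem_equations_iff_of_isHomogeneous hEn, aeval_adjoinLast_decomposition, add_assoc m,
        pow_add, hyF, Finset.mul_sum, Finset.mul_sum, ← Finset.sum_add_distrib] at hE
      rw [← hE]
      refine Finset.sum_congr rfl fun i _ => ?_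
      simp only [map_add, map_mul, map_pow, aeval_C, aeval_X, Algebra.algebraMap_self,
        RingHom.id_apply, adjoinLast, Option.elim]
      ring
    -- The syzygy lemma needs coefficients of positive degree; this is where r ≥ 1 enters.
    obtain ⟨l, hl⟩ : ∃ l, m + r = l + 1 := ⟨m + r - 1, by omega⟩
    rw [hdecomp]
    refine Ideal.add_mem _ (Ideal.mem_sup_left
      (Ideal.mul_mem_left _ _ (Ideal.mem_span_singleton_self _))) ?_
    have hspan := sum_X_mul_mem_span hz hreg hinf d _ (fun i => hl ▸ hH i)
      (fun i hi => absurd i.2 (by omega)) hsum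
    refine Ideal.span_le.mpr ?_ hspan
    rintro E' ⟨hE', hE'l⟩
    exact ih E' hE' (hl ▸ hE'l)

/-- I^(n+1) is generated by y^(n+1) together with J I^n, J being generated by x. -/
theorem pow_succ_eq_mul_pow_of_pow_mem (hz : Ideal.span (Set.range fun o => (adjoinLast x y o : R)) = I) {n : ℕ}
    (hy : (y : R) ^ (n + 1) ∈ Ideal.span (Set.range fun i => (x i : R)) * I ^ n) :
    I ^ (n + 1) = Ideal.span (Set.range fun i => (x i : R)) * I ^ n := by
  refine le_antisymm (fun f hf => ?_) ?_
  · obtain ⟨E, hE, rfl⟩ := exists_isHomogeneous_aeval_eq hz hf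
    obtain ⟨a, G, hG, rfl⟩ := exists_decomposition_of_isHomogeneous_succ hE
    rw [aeval_adjoinLast_decomposition]
    exact Ideal.add_mem _ (Ideal.mul_mem_left _ _ hy) (Ideal.sum_mem _ fun i _ =>
      Ideal.mul_mem_mul (Ideal.subset_span ⟨i, rfl⟩) (aeval_mem_pow hz (hG i)))
  · rw [pow_succ']
    refine Ideal.mul_mono_left (Ideal.span_le.mpr ?_)
    rintro _ ⟨i, rfl⟩
    exact (x i).2

/-- Reduction to the residue field followed by the specialization `X i ↦ 0`, `Y ↦ 1`. -/
noncomputable def specialization (R : Type*) [CommRing R] [IsLocalRing R] (d : ℕ) :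
    MvPolynomial (Option (Fin d)) R →+* ResidueField R :=
  eval₂Hom (residue R) fun o => o.elim 1 0

theorem specialization_decomposition [IsLocalRing R] (a : R)
    (G : Fin d → MvPolynomial (Option (Fin d)) R) (n : ℕ) :
    specialization R d (C a * X none ^ n + ∑ i, X (some i) * G i) = residue R a := by
  simp [specialization]

/-- A unit coefficient at Y^(k+1) in an equation of degree k + 1 ≤ r would give y^(k+1) ∈ J I^k, so
I^(k+1) = J I^k with k < r. -/
theorem equationsUpTo_le_ker_specialization [IsLocalRing R]
    (hz : Ideal.span (Set.range fun o => (adjoinLast x y o : R)) = I) {r : ℕ}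
    (hr : IsReductionNumber (Ideal.span (Set.range fun i => (x i : R))) I r) :
    equationsUpTo (adjoinLast x y) r ≤ RingHom.ker (specialization R d) := by
  refine Ideal.span_le.mpr ?_
  rintro E ⟨hE, k, hk, hEk⟩
  rw [SetLike.mem_coe, RingHom.mem_ker]
  rw [mem_equations_iff_of_isHomogeneous hEk] at hE
  rcases k with _ | k
  · rw [← totalDegree_zero_iff_isHomogeneous] at hEk
    rw [totalDegree_eq_zero_iff_eq_C.mp hEk] at hE ⊢
    rw [aeval_C] at hE
    have : coeff 0 E = 0 := hE
    rw [this, map_zero, map_zero]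
  · obtain ⟨a, G, hG, rfl⟩ := exists_decomposition_of_isHomogeneous_succ hEk
    rw [specialization_decomposition, residue_eq_zero_iff, mem_maximalIdeal, mem_nonunits_iff]
    intro ha
    rw [aeval_adjoinLast_decomposition] at hE
    refine absurd (hr.2 (pow_succ_eq_mul_pow_of_pow_mem hz (n := k) ?_)) (by omega)
    rw [← Ideal.unit_mul_mem_iff_mem _ ha, eq_neg_of_add_eq_zero_left hE]
    exact neg_mem (Ideal.sum_mem _ fun i _ =>
      Ideal.mul_mem_mul (Ideal.subset_span ⟨i, rfl⟩) (aeval_mem_pow hz (hG i)))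

/-- If r = 0, then I = J and y is redundant. -/
theorem IsMinimalGeneratingFamily.one_le_of_isReductionNumber
    (hz : IsMinimalGeneratingFamily (adjoinLast x y)) {r : ℕ}
    (hr : IsReductionNumber (Ideal.span (Set.range fun i => (x i : R))) I r) : 1 ≤ r := by
  by_contra h
  obtain rfl : r = 0 := by omega
  have h0 : I ^ (0 + 1) = Ideal.span (Set.range fun i => (x i : R)) * I ^ 0 := hr.1
  rw [zero_add, pow_one, pow_zero, Ideal.one_eq_top, Ideal.mul_top] at h0
  apply hz.2 none
  conv_rhs => rw [h0]
  congr 1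
  ext a
  constructor
  · rintro ⟨_ | i, hi, rfl⟩
    · exact absurd rfl hi
    · exact ⟨i, rfl⟩
  · rintro ⟨i, rfl⟩
    exact ⟨some i, Option.some_ne_none i, rfl⟩

end Top

end ReesEquations

open ReesEquations MvPolynomial in
theorem mainTheorem2 {R : Type*} [CommRing R] [IsLocalRing R]
    (hCM : IsCohenMacaulayLocal R) (d : ℕ) (hd : ringKrullDim R = d)
    (I : Ideal R) (hI : I.IsPrimary) (hIm : I.radical = IsLocalRing.maximalIdeal R)
    (x : Fin d → I) (y : I)
    (hgen : IsMinimalGeneratingFamily (adjoinLast x y))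
    (J : Ideal R) (hJ : J = Ideal.span (Set.range fun i => (x i : R)))
    (hred : IsReduction J I) (r : ℕ) (hr : IsReductionNumber J I r)
    (hG : RingTheory.Sequence.IsRegular (AssociatedGraded I)
      ((List.ofFn fun i => initialForm I (x i : R)).take (d - 1))) :
    (∃ F : Fin d → MvPolynomial (Option (Fin d)) R,
      (∀ i, (F i).IsHomogeneous r) ∧
      (X none ^ (r + 1) - ∑ i, X (some i) * F i :
        MvPolynomial (Option (Fin d)) R).IsHomogeneous (r + 1) ∧
      X none ^ (r + 1) - ∑ i, X (some i) * F i ∈ equations (adjoinLast x y) ∧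
      equations (adjoinLast x y) =
        Ideal.span {X none ^ (r + 1) - ∑ i, X (some i) * F i} ⊔
          equationsUpTo (adjoinLast x y) r) ∧
    IsRelationType (adjoinLast x y) (r + 1) := by
  subst hJ
  have hnoeth := hCM.isNoetherianRing
  have hz := hgen.1
  have hr1 := hgen.one_le_of_isReductionNumber hr
  have hx2 : ∀ i, (x i : R) ∉ I ^ 2 := fun i => hgen.not_mem_sq hI.1 (some i)
  have hinit := isInitiallyRegular_of_isWeaklyRegular (fun i => (x i).2) hx2
    hG.toIsWeaklyRegular
  have hinf : ∀ (i : Fin d) (n : ℕ), partialSpan (fun i => (x i : R)) i ⊓ I ^ n ≤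
      partialSpan (fun i => (x i : R)) i * I ^ (n - 1) := fun i =>
    -- Here j < i ≤ d - 1, so the first d - 1 initial forms suffice.
    partialSpan_inf_pow_le (fun i => (x i).2) i.2.le fun j hj => hinit j (by omega)
  obtain ⟨N, hN⟩ := I.exists_radical_pow_le_of_fg (IsNoetherian.noetherian _)
  have hNJ : IsLocalRing.maximalIdeal R ^ (N * (r + 1)) ≤
      Ideal.span (Set.range fun i => (x i : R)) := by
    rw [pow_mul, ← hIm]
    exact (Ideal.pow_right_mono hN _).trans (hr.1.le.trans Ideal.mul_le_left)
  have hreg := isRegularModulo_partialSpan hI.1 (fun i => (x i).2) (hCM.hasRegularSequence hd)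
    hinit hNJ
  obtain ⟨F, hF, hyF⟩ := exists_equation_of_pow_eq hz hr.1
  have hhom := isHomogeneous_X_pow_sub_sum hF
  have hmem : X none ^ (r + 1) - ∑ i, X (some i) * F i ∈ equations (adjoinLast x y) := by
    rw [mem_equations_iff_of_isHomogeneous hhom]
    simp only [map_sub, map_sum, map_mul, map_pow, aeval_X]
    exact sub_eq_zero.mpr hyF
  have hQ : equations (adjoinLast x y) =
      Ideal.span {X none ^ (r + 1) - ∑ i, X (some i) * F i} ⊔
        equationsUpTo (adjoinLast x y) r := by
    refine le_antisymm (fun E hE => ?_) (sup_le ?_ (equationsUpTo_le_equations _ _))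
    · rw [← sum_homogeneousComponent E]
      exact Ideal.sum_mem _ fun n _ => mem_span_sup_equationsUpTo hz hreg hinf hr1 hF hyF n _
        (homogeneousComponent_mem_equations hE n) (homogeneousComponent_isHomogeneous n E)
    · exact (Ideal.span_singleton_le_iff_mem _).mpr hmem
  refine ⟨⟨F, hF, hhom, hmem, hQ⟩, ⟨by omega, ?_⟩, fun n hn => ?_⟩
  · refine le_antisymm ?_ (equationsUpTo_le_equations _ _)
    rw [hQ]
    exact sup_le ((Ideal.span_singleton_le_iff_mem _).mpr
      (Ideal.subset_span ⟨hmem, r + 1, le_rfl, hhom⟩)) (equationsUpTo_mono _ (Nat.le_succ r))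
  -- If n ≤ r, the top equation would lie in the kernel of the specialization, which sends it to 1.
  · by_contra hlt
    have h1 := equationsUpTo_le_ker_specialization hz hr
      (equationsUpTo_mono _ (show n ≤ r by omega) (hn.2 ▸ hmem))
    have h2 := specialization_decomposition (1 : R) (fun i => -F i) (r + 1)
    simp only [map_one, one_mul, mul_neg, Finset.sum_neg_distrib, ← sub_eq_add_neg] at h2
    rw [RingHom.mem_ker, h2] at h1
    exact one_ne_zero h1
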